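/- **Theorem (convex neighborhoods).** A configuration $c\in\{0,1\}^{\mathbb Z^2}$ is a $(D,b,a)$-covering, for a finite set $D\subseteq\mathbb Z^2$ and non-negative integers $b,a$, if for every $u\in\mathbb Z^2$ the set $u+D$ contains exactly $b$ points $w$ with $c_w=1$ when $c_u=1$, and exactly $a$ such points when $c_u=0$. It is periodic if it is invariant under translation by some non-zero vector of $\mathbb Z^2$, and two-periodic if it is invariant under translation by two linearly independent vectors. Let $D\subseteq\mathbb Z^2$ be finite and convex, that is, $D=\operatorname{conv}(D)\cap\mathbb Z^2$, let $b,a\ge 0$ be integers, and assume that the Laurent polynomial $g=\sum_{u\in D}X^{-u}-(b-a)\in\mathbb C[x^{\pm1},y^{\pm1}]$ is not zero. Let $E$ be the set of outer edge directions of $g$, that is, the set of all vectors $v=(v_1,v_2)\in\mathbb Z^2$ with coprime components such that, for some $t\in\mathbb Z^2$, every $u$ in the support of $g$ satisfies $\langle u-t,(v_2,-v_1)\rangle\ge 0$, with equality for at least two such $u$. For $v\in E$, the $v$-fibers of $g=\sum_u g_uX^u$ are the polynomials $\sum_{k\in\mathbb Z}g_{u+kv}X^{u+kv}$, $u\in\mathbb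 Z^2$. A non-zero $v$-fiber can be written uniquely as $X^{w}p(X^v)$ with $w \in \mathbb Z^2$ and $p\in\mathbb C[t]$, $p(0)\ne 0$, and $p$ is called its normal form; the normal form of the zero fiber is $0$. Let $\mathcal F_v(g)$ be the set of normal forms of all non-zero $v$-fibers of $g$, let $\mathcal F'_v(g)$ be the set of normal forms of the non-zero $v$-fibers with $u\notin\mathbb Zv$, and let $\operatorname{fib}_v(g)$ be the normal form of the $v$-fiber with $u=0$. Put $\varphi_n=1+t+\dots+t^{n-1}$, so $\varphi_0=0$ and $\varphi_1=1$; the gcd of the empty set is $0$. 1. Assume $b-a=0$. For every $v\in E$ we have $\mathcal F_v(g)=\{\varphi_{n_1},\dots,\varphi_{n_r}\}$ for some $n_1,\dots,n_r\ge 1$; put $d_v=\gcd(n_1,\dots,n_r)$. If $d_v=1$ for all $v\in E$, then every $(D,b,a)$-covering is two-periodic. If any two $v\in E$ with $d_v\ne 1$ are parallel, then every $(D,b,a)$-covering is periodic. 2. Assume $b-a\neq0$. For every $v\in E$ we have $\mathcal F'_v(g)=\{\varphi_{n_1},\dots,\varphi_{n_r}\}$ for some $r\ge 0$ and $n_1,\dots,n_r\ge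 1$; put $d_v=\gcd(n_1,\dots,n_r)$. If for all $v\in E$ the polynomials $\varphi_{d_v}$ and $\operatorname{fib}_v(g)$ have no common factor in $\mathbb C[t]$ other than units, then every $(D,b,a)$-covering is two-periodic. If any two $v\in E$ for which this condition fails are parallel, then every $(D,b,a)$-covering is periodic. The condition holds at $v\in E$, in particular, if $d_v=1$. -/

import Mathlib

namespace PerfectCovering

/-- The grid `ℤ²`. -/
abbrev Grid : Type := ℤ × ℤ

/-! ### Configurations, periodicity and coverings -/

/-- The translation `τ^t`, with `τ^t(c)_u = c_{u - t}`. -/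
def translate (t : Grid) (c : Grid → Fin 2) : Grid → Fin 2 := fun u => c (u - t)

/-- A configuration is periodic if it is invariant under some non-zero translation. -/
def IsPeriodic (c : Grid → Fin 2) : Prop := ∃ t : Grid, t ≠ 0 ∧ translate t c = c

/-- A configuration is two-periodic if it has two linearly independent vectors of periodicity. -/
def IsTwoPeriodic (c : Grid → Fin 2) : Prop :=
  ∃ t₁ t₂ : Grid, LinearIndependent ℤ ![t₁, t₂] ∧ translate t₁ c = c ∧ translate t₂ c = c

/-- `c` is a `(D, b, a)`-covering: the pattern of `c` on `u + D` contains exactly `b` symbols `1`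
if `c u = 1`, and exactly `a` symbols `1` if `c u = 0`. -/
def IsCovering (D : Finset Grid) (b a : ℕ) (c : Grid → Fin 2) : Prop :=
  ∀ u : Grid, (c u = 1 → (D.filter (fun w => c (u + w) = 1)).card = b) ∧
    (c u = 0 → (D.filter (fun w => c (u + w) = 1)).card = a)

/-! ### Convex shapes and outer edges -/

/-- The embedding of `ℤ²` into `ℝ²`. -/
def toReal (u : Grid) : ℝ × ℝ := ((u.1 : ℝ), (u.2 : ℝ))

/-- `D = conv(D) ∩ ℤ²`. -/
def IsConvexShape (D : Finset Grid) : Prop :=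
  (D : Set Grid) = {u | toReal u ∈ convexHull ℝ (toReal '' (D : Set Grid))}

/-- The inner product `⟨u, v^⊥⟩` with `v^⊥ = (v₂, -v₁)`. -/
def innerPerp (u v : Grid) : ℤ := u.1 * v.2 - u.2 * v.1

/-- `S` has an outer edge in direction `v`: a translate of the closed half plane
`{u | 0 ≤ ⟨u, v^⊥⟩}` contains `S`, and its boundary line meets `S` in at least two points. -/
def HasOuterEdge (S : Finset Grid) (v : Grid) : Prop :=
  ∃ t : Grid, (∀ u ∈ S, 0 ≤ innerPerp (u - t) v) ∧
    2 ≤ (S.filter (fun u => innerPerp (u - t) v = 0)).card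

/-- A vector is primitive if its components are relatively prime. In particular it is non-zero. -/
def IsPrimitive (v : Grid) : Prop := IsCoprime v.1 v.2

/-- Two vectors are parallel if one is a rational multiple of the other (the determinant
criterion for non-zero vectors). -/
def IsParallel (v w : Grid) : Prop := innerPerp v w = 0

/-! ### Laurent polynomials and their fibers -/

/-- Laurent polynomials in two variables over `ℂ`; the monomial `r X^u` is `single u r`. -/
abbrev LPoly : Type := AddMonoidAlgebra ℂ Grid

/-- The characteristic polynomial `f_D = ∑_{u ∈ D} X^{-u}`. -/
noncomputable def charPoly (D : Finset Grid) : LPoly :=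
  ∑ u ∈ D, AddMonoidAlgebra.single (-u) (1 : ℂ)

/-- The polynomial `g = f_D - (b - a)`. -/
noncomputable def coveringPoly (D : Finset Grid) (b a : ℕ) : LPoly :=
  charPoly D - AddMonoidAlgebra.single 0 ((b : ℂ) - (a : ℂ))

/-- The (primitive representatives of the) outer edge directions of a polynomial. -/
def outerEdgeDirections (f : LPoly) : Set Grid :=
  {v | IsPrimitive v ∧ HasOuterEdge f.coeff.support v}

open Classical in
/-- The `v`-fiber `∑_k f_{u + k v} X^{u + k v}` of `f` through `u`. -/
noncomputable def fiber (v : Grid) (f : LPoly) (u : Grid) : LPoly :=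
  AddMonoidAlgebra.ofCoeff (f.coeff.filter (fun w => ∃ k : ℤ, w = u + k • v))

/-- `p = a₀ + a₁ t + ⋯ + aₙ tⁿ` is the normal form of `h` in direction `v`: `a₀ ≠ 0` and
`h = X^u (a₀ + a₁ X^v + ⋯ + aₙ X^{n v})` for some `u`. -/
def IsNormalForm (v : Grid) (h : LPoly) (p : Polynomial ℂ) : Prop :=
  p.coeff 0 ≠ 0 ∧ ∃ u : Grid, h = AddMonoidAlgebra.single u (1 : ℂ) *
    Polynomial.aeval (AddMonoidAlgebra.single v (1 : ℂ) : LPoly) p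

open Classical in
/-- The normal form in direction `v` of a monomial or of a line polynomial in direction `v`;
the normal form of `0` is `0`. -/
noncomputable def normalForm (v : Grid) (h : LPoly) : Polynomial ℂ :=
  if H : ∃ p, IsNormalForm v h p then H.choose else 0

/-- `F_v(f)`: the set of the normal forms of all non-zero `v`-fibers of `f`. -/
def fiberForms (v : Grid) (f : LPoly) : Set (Polynomial ℂ) :=
  {p | ∃ u : Grid, fiber v f u ≠ 0 ∧ p = normalForm v (fiber v f u)}

/-- `F'_v(f)`: the set of the normal forms of the non-zero `v`-fibers of `f` that do not pass
through the origin. -/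
def fiberForms' (v : Grid) (f : LPoly) : Set (Polynomial ℂ) :=
  {p | ∃ u : Grid, (∀ k : ℤ, u ≠ k • v) ∧ fiber v f u ≠ 0 ∧ p = normalForm v (fiber v f u)}

/-- `fib_v(f)`: the normal form of the `v`-fiber of `f` through the origin. -/
noncomputable def originForm (v : Grid) (f : LPoly) : Polynomial ℂ :=
  normalForm v (fiber v f 0)

/-- `φ_n = 1 + t + ⋯ + t^{n-1}`; thus `φ_0 = 0` and `φ_1 = 1`. -/
noncomputable def phi (n : ℕ) : Polynomial ℂ := ∑ i ∈ Finset.range n, Polynomial.X ^ i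

/-- The set `{n₁, …, n_r}` of all `n ≥ 1` such that `φ_n` belongs to `F`. -/
def lengths (F : Set (Polynomial ℂ)) : Set ℕ := {n | 1 ≤ n ∧ phi n ∈ F}

end PerfectCovering

/-!
Let `g` be the polynomial of the shape `D`. A configuration `c` is a covering only if `g c` is
constant, where Laurent polynomials act on functions `ℤ² → ℂ` by translations, so that `c` is
annihilated by all polynomials `(X^t - 1) g`. Periodicity is read off from annihilators of the form
`∏ (X^v - 1)`, in three steps.

*Existence.* A bounded integer configuration with a non-zero annihilator `f` is annihilated by some
product of difference polynomials `X^v - 1` (`exists_prod_diff_annihilates`). By the congruence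
`f(X)^p ≡ f(X^p)` modulo primes `p` that are large compared with the values involved, `f(X^n)`
annihilates `c` for all `n = 1 + kM`; these polynomials are Vandermonde combinations of the terms of
`f`, and eliminating all terms but one gives the product.

*Removal of factors.* Suppose that the product has a factor `X^{Nv} - 1` with `v` primitive, and let
`e` be the `Nv`-periodic configuration obtained from `c` by applying the other factors. If
`g` does not vanish under any evaluation `X^v = ζ` with `ζ^N = 1`, then the product of these
evaluations is a non-zero linear recurrence satisfied by `e` in a second direction. As `e` takes
finitely many values, it is two-periodic (`exists_two_periods`). The factor `X^{Nv} - 1` can then be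
replaced by a multiple of another factor, and the two merge, since squares of difference polynomials
are redundant on configurations with finitely many values
(`act_diff_eq_zero_of_act_diff_act_diff`). Hence `c` is two-periodic, or one factor in a direction
along which `g` vanishes is left, or `g` vanishes along two non-parallel directions
(`covering_periodicity`).

*Fibers.* The evaluation of `g` at `X^v = ζ` vanishes precisely when `ζ` is a common root of the
normal forms of the `v`-fibers. This is impossible if some fiber is a monomial, which leaves the
outer edge directions. Convexity makes the fibers not meeting the constant term geometric sums
`φ_n` (`exists_normalForm_eq_phi`), and a common root of several `φ_n` is a root of `φ_d` for the
greatest common divisor `d` of the numbers `n` (`eval_phi_setGcd`).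
-/

namespace PerfectCovering

open AddMonoidAlgebra

/-! ### Group algebras acting on functions by translations -/

section Action

variable {R : Type*} [CommRing R] {G : Type*} [AddCommGroup G]

/-- The action of the group algebra `R[G]` on functions `G → R`, in which the monomial `X^t` acts as
the translation `(X^t c)_u = c_{u - t}`. -/
noncomputable def act : AddMonoidAlgebra R G →ₐ[R] Module.End R (G → R) :=
  AddMonoidAlgebra.lift R (Module.End R (G → R)) G
    { toFun := fun t => LinearMap.funLeft R R (fun u => u - t.toAdd)
      map_one' := by
        ext c u
        simp [LinearMap.funLeft]
      map_mul' := fun s t => by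
        refine LinearMap.ext fun c => funext fun u => ?_
        simp [LinearMap.funLeft_apply, sub_sub] }

theorem act_single (t : G) (r : R) (c : G → R) (u : G) :
    act (single t r) c u = r * c (u - t) := by
  simp [act, AddMonoidAlgebra.lift_single, LinearMap.funLeft_apply]

theorem act_apply (f : AddMonoidAlgebra R G) (c : G → R) (u : G) :
    act f c u = ∑ t ∈ f.coeff.support, f.coeff t * c (u - t) := by
  simp [act, AddMonoidAlgebra.lift_apply, Finsupp.sum, LinearMap.funLeft_apply]

theorem act_mul (f g : AddMonoidAlgebra R G) (c : G → R) : act (f * g) c = act f (act g c) := by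
  simp

theorem act_mul' (f g : AddMonoidAlgebra R G) (c : G → R) : act (f * g) c = act g (act f c) := by
  rw [mul_comm, act_mul]

theorem act_eq_zero_of_dvd {f g : AddMonoidAlgebra R G} (h : f ∣ g) {c : G → R}
    (hf : act f c = 0) : act g c = 0 := by
  obtain ⟨k, rfl⟩ := h
  rw [act_mul', hf, map_zero]

/-- The difference polynomial `X^t - 1`. -/
noncomputable def diff (R : Type*) [CommRing R] (t : G) : AddMonoidAlgebra R G := single t 1 - 1

theorem act_diff (t : G) (c : G → R) (u : G) : act (diff R t) c u = c (u - t) - c u := by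
  rw [diff, map_sub, map_one]
  simp [act_single]

theorem act_diff_eq_zero_iff {t : G} {c : G → R} :
    act (diff R t) c = 0 ↔ ∀ u, c (u - t) = c u := by
  simp [funext_iff, act_diff, sub_eq_zero]

theorem diff_dvd_diff_zsmul (t : G) (n : ℤ) : diff R t ∣ diff R (n • t) := by
  have key : ∀ k : ℕ, diff R t ∣ diff R (k • t) := fun k => by
    have := sub_dvd_pow_sub_pow (single t 1 : AddMonoidAlgebra R G) 1 k
    simpa [diff, single_pow] using this
  obtain ⟨k, rfl | rfl⟩ := n.eq_nat_or_neg
  · simpa using key k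
  · have h : diff R (-(k : ℤ) • t) = -single (-(k : ℤ) • t) 1 * diff R (k • t) := by
      simp [diff, mul_sub, single_mul_single, one_def]
      abel
    rw [h]
    exact (key k).mul_left _

/-- Change of coefficients commutes with the action. -/
theorem act_mapRingHom {S : Type*} [CommRing S] (φ : R →+* S) (f : AddMonoidAlgebra R G)
    (c : G → R) (u : G) : act (mapRingHom G φ f) (φ ∘ c) u = φ (act f c u) := by
  induction f using AddMonoidAlgebra.induction_linear with
  | zero => simp
  | add f g hf hg => simp [hf, hg]
  | single t r => simp [act_single]

/-- The substitution `X ↦ X^n`. -/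
noncomputable def dilate (n : ℕ) : AddMonoidAlgebra R G →ₐ[R] AddMonoidAlgebra R G :=
  AddMonoidAlgebra.lift R _ G
    { toFun := fun t => single (n • t.toAdd) 1
      map_one' := by simp [one_def]
      map_mul' := fun s t => by simp [single_mul_single] }

theorem dilate_single (n : ℕ) (t : G) (r : R) : dilate n (single t r) = single (n • t) r := by
  simp [dilate, AddMonoidAlgebra.lift_single]

theorem dilate_eq_sum (n : ℕ) (f : AddMonoidAlgebra R G) :
    dilate n f = ∑ t ∈ f.coeff.support, single (n • t) (f.coeff t) := by
  conv_lhs => rw [← sum_coeff_single f]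
  simp [Finsupp.sum, map_sum, dilate_single]

theorem dilate_one (f : AddMonoidAlgebra R G) : dilate 1 f = f := by
  induction f using AddMonoidAlgebra.induction_linear with
  | zero => simp
  | add f g hf hg => simp [hf, hg]
  | single t r => simp [dilate_single]

theorem dilate_dilate (m n : ℕ) (f : AddMonoidAlgebra R G) :
    dilate m (dilate n f) = dilate (m * n) f := by
  induction f using AddMonoidAlgebra.induction_linear with
  | zero => simp
  | add f g hf hg => simp [hf, hg]
  | single t r => simp [dilate_single, mul_smul]

theorem act_dilate (n : ℕ) (f : AddMonoidAlgebra R G) (c : G → R) (u : G) :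
    act (dilate n f) c u = ∑ t ∈ f.coeff.support, f.coeff t * c (u - n • t) := by
  simp [dilate_eq_sum, map_sum, act_single]

end Action

/-! ### Annihilators of bounded integer configurations -/

section Annihilator

variable {G : Type*} [AddCommGroup G]

/-- The Frobenius congruence `f(X)^p ≡ f(X^p)` modulo `p`. -/
theorem dvd_pow_sub_dilate {p : ℕ} (hp : p.Prime) (f : AddMonoidAlgebra ℤ G) :
    (p : AddMonoidAlgebra ℤ G) ∣ f ^ p - dilate p f := by
  induction f using AddMonoidAlgebra.induction_linear with
  | zero => simp [hp.ne_zero]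
  | add f g hf hg =>
    obtain ⟨r, hr⟩ := exists_add_pow_prime_eq hp f g
    rw [hr, map_add]
    convert (hf.add hg).add (dvd_mul_right (p : AddMonoidAlgebra ℤ G) (f * g * r)) using 1
    ring
  | single t r =>
    have := Fact.mk hp
    obtain ⟨k, hk⟩ : (p : ℤ) ∣ r ^ p - r := by
      rw [← ZMod.intCast_zmod_eq_zero_iff_dvd]
      simp [ZMod.pow_card]
    refine ⟨single (p • t) k, ?_⟩
    rw [dilate_single, single_pow, ← single_sub, hk, natCast_def, single_mul_single]
    simp

/-- If `f` annihilates a bounded integer configuration, so does `f(X^n)` for all `n` in an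
arithmetic progression starting at `1`: the values of `f(X^n) c` are bounded independently of `n`,
and they are divisible by the prime `p` when `f(X^{n/p})` annihilates `c`. -/
theorem exists_dilate_annihilates {c : G → ℤ} {C : ℤ} (hC : ∀ u, |c u| ≤ C)
    {f : AddMonoidAlgebra ℤ G} (hf : act f c = 0) :
    ∃ M : ℕ, 0 < M ∧ ∀ k : ℕ, act (dilate (1 + k * M) f) c = 0 := by
  set B : ℤ := ∑ t ∈ f.coeff.support, |f.coeff t| * C with hB
  have bound : ∀ n u, |act (dilate n f) c u| ≤ B := fun n u => by
    rw [act_dilate]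
    refine (Finset.abs_sum_le_sum_abs _ _).trans (Finset.sum_le_sum fun t _ => ?_)
    rw [abs_mul]
    exact mul_le_mul_of_nonneg_left (hC _) (abs_nonneg _)
  have main : ∀ n : ℕ, n ≠ 0 → (∀ p : ℕ, p.Prime → p ∣ n → B < p) →
      act (dilate n f) c = 0 := by
    intro n
    induction n using induction_on_primes with
    | zero => exact fun h => absurd rfl h
    | one => exact fun _ _ => by rwa [dilate_one]
    | prime_mul p n hp ih =>
      intro h0 hB'
      have hn := ih (right_ne_zero_of_mul h0) fun q hq hd => hB' q hq (hd.mul_left p)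
      obtain ⟨k, hk⟩ := dvd_pow_sub_dilate hp (dilate n f)
      rw [dilate_dilate, sub_eq_iff_eq_add] at hk
      have hpow : act (dilate n f ^ p) c = 0 :=
        act_eq_zero_of_dvd (dvd_pow_self _ hp.ne_zero) hn
      funext u
      have hdvd : (p : ℤ) ∣ act (dilate (p * n) f) c u := by
        refine ⟨-act k c u, ?_⟩
        have := congrFun hpow u
        rw [hk, map_add, LinearMap.add_apply, act_mul, map_natCast] at this
        simp at this
        simp
        linarith
      exact Int.eq_zero_of_abs_lt_dvd hdvd
        ((bound _ u).trans_lt (hB' p hp (dvd_mul_right p n)))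
  -- a prime factor of `1 + k B!` is larger than `B`
  refine ⟨B.toNat.factorial, Nat.factorial_pos _, fun k => main _ (by omega) fun p hp hd => ?_⟩
  by_contra! hle
  have h1 : p ∣ B.toNat.factorial := (hp.dvd_factorial).2 (by omega)
  exact hp.one_lt.ne' (Nat.dvd_one.1 ((Nat.dvd_add_left (h1.mul_left k)).1 hd))

/-- A bounded integer configuration with a non-zero annihilator is annihilated by a product of
difference polynomials. The polynomials `f(X^{1 + kM}) = ∑ᵢ fᵢ X^{uᵢ} (X^{M uᵢ})^k` are combined
with the coefficients of `∏_{j ≠ 0} (T - X^{M uⱼ})`, as in the inversion of a Vandermonde matrix, so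
that only the term `i = 0` remains. -/
theorem exists_prod_diff_annihilates [IsAddTorsionFree G] {c : G → ℤ} {C : ℤ}
    (hC : ∀ u, |c u| ≤ C) {f : AddMonoidAlgebra ℤ G} (hf0 : f ≠ 0) (hf : act f c = 0) :
    ∃ L : List G, (∀ v ∈ L, v ≠ 0) ∧ act ((L.map (diff ℤ)).prod) c = 0 := by
  classical
  obtain ⟨M, hM, hk⟩ := exists_dilate_annihilates hC hf
  obtain ⟨u₀, hu₀⟩ : f.coeff.support.Nonempty := by
    rw [Finsupp.support_nonempty_iff]; simpa using hf0
  set S := f.coeff.support.erase u₀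
  let x : G → AddMonoidAlgebra ℤ G := fun j => single (M • j) 1
  let P : Polynomial (AddMonoidAlgebra ℤ G) :=
    ∏ j ∈ S, (Polynomial.X - Polynomial.C (x j))
  have hP : ∑ k ∈ Finset.range (P.natDegree + 1), P.coeff k * dilate (1 + k * M) f =
      single u₀ (f.coeff u₀) * ∏ j ∈ S, (x u₀ - x j) := by
    calc _ = ∑ i ∈ f.coeff.support, single i (f.coeff i) * P.eval (x i) := by
          simp_rw [dilate_eq_sum, Finset.mul_sum]
          rw [Finset.sum_comm]
          refine Finset.sum_congr rfl fun i _ => ?_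
          rw [Polynomial.eval_eq_sum_range, Finset.mul_sum]
          refine Finset.sum_congr rfl fun k _ => ?_
          rw [mul_left_comm, single_pow, single_mul_single]
          simp [add_smul, mul_smul]
      _ = _ := by
          rw [Finset.sum_eq_single_of_mem u₀ hu₀]
          · simp [P, Polynomial.eval_prod]
          · intro i hi hne
            have : P.eval (x i) = 0 := by
              rw [Polynomial.eval_prod]
              exact Finset.prod_eq_zero (Finset.mem_erase.2 ⟨hne, hi⟩) (by simp)
            rw [this, mul_zero]
  have h1 : act (single u₀ (f.coeff u₀) * ∏ j ∈ S, (x u₀ - x j)) c = 0 := by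
    rw [← hP, map_sum, LinearMap.sum_apply]
    exact Finset.sum_eq_zero fun k _ => by rw [act_mul, hk, map_zero]
  have h2 : act (∏ j ∈ S, (x u₀ - x j)) c = 0 := by
    funext u
    have := congrFun h1 (u + u₀)
    rw [act_mul, act_single] at this
    simpa [Finsupp.mem_support_iff.1 hu₀] using this
  have h3 : ∀ j, x u₀ - x j ∣ diff ℤ (M • (j - u₀)) := fun j =>
    ⟨-single (-(M • u₀)) 1, by
      simp only [x, diff, mul_neg, sub_mul, single_mul_single, one_def, smul_sub]
      simp [sub_eq_add_neg]⟩
  refine ⟨S.toList.map fun j => M • (j - u₀), ?_, ?_⟩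
  · simp only [List.mem_map, Finset.mem_toList, forall_exists_index, and_imp]
    rintro _ j hj rfl
    simp [hM.ne', sub_eq_zero, Finset.ne_of_mem_erase hj]
  · refine act_eq_zero_of_dvd ?_ h2
    rw [List.map_map, Finset.prod_map_toList]
    exact Finset.prod_dvd_prod_of_dvd _ _ fun j _ => h3 j

end Annihilator

/-! ### Configurations with finitely many values -/

section FiniteRange

variable {R : Type*} [CommRing R] {G : Type*} [AddCommGroup G]

theorem finite_range_act (f : AddMonoidAlgebra R G) {c : G → R} (hc : (Set.range c).Finite) :
    (Set.range (act f c)).Finite := by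
  induction f using AddMonoidAlgebra.induction_linear with
  | zero => exact (Set.finite_singleton 0).subset (by rintro _ ⟨u, rfl⟩; simp)
  | add f g hf hg =>
    refine (Set.Finite.image2 (· + ·) hf hg).subset ?_
    rintro _ ⟨u, rfl⟩
    exact ⟨_, ⟨u, rfl⟩, _, ⟨u, rfl⟩, by simp⟩
  | single t r =>
    refine (hc.image (r * ·)).subset ?_
    rintro _ ⟨u, rfl⟩
    exact ⟨_, ⟨u - t, rfl⟩, (act_single t r c u).symm⟩

/-- A configuration with finitely many values has no non-constant arithmetic progressions along a
line, so repeated difference polynomials can be dropped from an annihilator. -/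
theorem act_diff_eq_zero_of_act_diff_act_diff [IsDomain R] [CharZero R] {v : G} {c : G → R}
    (hc : (Set.range c).Finite) (h : act (diff R v) (act (diff R v) c) = 0) :
    act (diff R v) c = 0 := by
  rw [act_diff_eq_zero_iff] at h
  funext u
  by_contra hne
  set d := act (diff R v) c with hd
  have hconst : ∀ n : ℕ, d (u - n • v) = d u := by
    intro n
    induction n with
    | zero => simp
    | succ n ih => rw [← ih, ← h (u - n • v), succ_nsmul, sub_sub]
  have hlin : ∀ n : ℕ, c (u - n • v) = c u + n * d u := by
    intro n
    induction n with
    | zero => simp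
    | succ n ih =>
      have := hconst n
      rw [hd, act_diff, ih, sub_sub, ← succ_nsmul] at this
      rw [sub_eq_iff_eq_add.1 this]
      push_cast
      ring
  have hinj : Function.Injective fun n : ℕ => c (u - n • v) := by
    intro m n hmn
    simp only [hlin] at hmn
    exact_mod_cast mul_right_cancel₀ hne (add_left_cancel hmn)
  exact Set.infinite_of_injective_forall_mem hinj (fun n => Set.mem_range_self _) hc

end FiniteRange

/-! ### Linear recurrences -/

section Recurrence

/-- A solution of a linear recurrence which vanishes on a window as long as the order of the
recurrence is zero. -/
theorem eq_zero_of_recurrence {K : Type*} [Field K] {h : AddMonoidAlgebra K ℤ}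
    (hne : h.coeff.support.Nonempty) {d : ℤ → K} (hd : act h d = 0) {i : ℤ}
    (h0 : ∀ k, i ≤ k → k < i + (h.coeff.support.max' hne - h.coeff.support.min' hne) → d k = 0) :
    d = 0 := by
  set hi := h.coeff.support.max' hne
  set lo := h.coeff.support.min' hne
  have hlo : lo ∈ h.coeff.support := Finset.min'_mem _ _
  have hhi : hi ∈ h.coeff.support := Finset.max'_mem _ _
  have hle : ∀ t ∈ h.coeff.support, lo ≤ t ∧ t ≤ hi := fun t ht =>
    ⟨Finset.min'_le _ _ ht, Finset.le_max' _ _ ht⟩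
  have step : ∀ t₀ ∈ h.coeff.support, ∀ j,
      (∀ t ∈ h.coeff.support, t ≠ t₀ → d (j + t₀ - t) = 0) → d j = 0 := by
    intro t₀ ht₀ j hj
    have := congrFun hd (j + t₀)
    rw [act_apply, Finset.sum_eq_single_of_mem t₀ ht₀
      (fun t ht hne => by rw [hj t ht hne, mul_zero])] at this
    simpa [Finsupp.mem_support_iff.1 ht₀] using this
  have fwd : ∀ m : ℕ, ∀ k, i ≤ k → k < i + (hi - lo) + m → d k = 0 := by
    intro m
    induction m with
    | zero => simpa using h0
    | succ m ih =>
      intro k hk1 hk2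
      by_cases hk : k < i + (hi - lo) + m
      · exact ih k hk1 hk
      · refine step lo hlo k fun t ht hne => ih _ ?_ ?_ <;>
        · have := hle t ht
          omega
  have bwd : ∀ m : ℕ, ∀ k, i - m ≤ k → d k = 0 := by
    intro m
    induction m with
    | zero => exact fun k hk => fwd (k - i + 1).toNat k (by omega) (by
        have := hle lo hlo
        omega)
    | succ m ih =>
      intro k hk
      by_cases hk' : i - m ≤ k
      · exact ih k hk'
      · refine step hi hhi k fun t ht hne => ih _ ?_
        have := hle t ht
        omega
  funext k
  exact bwd (i - k).toNat k (by omega)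

/-- All solutions of a linear recurrence with values in a given finite set have a common period. -/
theorem exists_period_of_recurrence {K : Type*} [Field K] {h : AddMonoidAlgebra K ℤ} (h0 : h ≠ 0)
    {F : Set K} (hF : F.Finite) :
    ∃ T : ℕ, 0 < T ∧ ∀ s : ℤ → K, (∀ i, s i ∈ F) → act h s = 0 → ∀ i, s (i - T) = s i := by
  have hne : h.coeff.support.Nonempty := by
    rw [Finsupp.support_nonempty_iff]; simpa using h0
  have := hF.fintype
  set n := (h.coeff.support.max' hne - h.coeff.support.min' hne).toNat with hn
  -- two of the first `|F|^n + 1` windows of length `n` coincide, and their distance divides this `T`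
  refine ⟨(Fintype.card F ^ n).factorial, Nat.factorial_pos _, fun s hs hact => ?_⟩
  obtain ⟨j₁, j₂, hj, hwin⟩ := Fintype.exists_ne_map_eq_of_card_lt
    (fun (j : Fin (Fintype.card F ^ n + 1)) (k : Fin n) => (⟨s (j + k), hs _⟩ : F)) (by simp)
  wlog hlt : j₁ < j₂ generalizing j₁ j₂
  · exact this j₂ j₁ hj.symm hwin.symm (lt_of_le_of_ne (not_lt.1 hlt) hj.symm)
  have hper : act (diff K (((j₂ - j₁ : ℕ)) : ℤ)) s = 0 := by
    refine eq_zero_of_recurrence hne (i := (j₂ : ℤ)) ?_ fun k hk1 hk2 => ?_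
    · rw [← act_mul, act_mul', hact, map_zero]
    · have h1 := congrFun hwin ⟨(k - j₂).toNat, by omega⟩
      simp only [Subtype.mk.injEq] at h1
      rw [act_diff, sub_eq_zero]
      convert h1 using 2 <;> omega
  have hdvd : j₂.val - j₁.val ∣ (Fintype.card F ^ n).factorial :=
    Nat.dvd_factorial (by omega) (by omega)
  obtain ⟨q, hq⟩ := hdvd
  refine act_diff_eq_zero_iff.1 (act_eq_zero_of_dvd ?_ hper)
  rw [hq]
  simpa [mul_comm] using diff_dvd_diff_zsmul (R := K) ((j₂.val - j₁.val : ℕ) : ℤ) (q : ℤ)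

end Recurrence

/-! ### Evaluating a Laurent polynomial along a direction -/

section Slice

theorem innerPerp_add_left (a b v : Grid) :
    innerPerp (a + b) v = innerPerp a v + innerPerp b v := by
  simp [innerPerp]; ring

theorem innerPerp_add_right (v a b : Grid) :
    innerPerp v (a + b) = innerPerp v a + innerPerp v b := by
  simp [innerPerp]; ring

theorem innerPerp_sub_left (a b v : Grid) :
    innerPerp (a - b) v = innerPerp a v - innerPerp b v := by
  simp [innerPerp]; ring

theorem innerPerp_smul_left (k : ℤ) (a v : Grid) : innerPerp (k • a) v = k * innerPerp a v := by
  simp [innerPerp]; ring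

theorem innerPerp_smul_right (k : ℤ) (a v : Grid) : innerPerp a (k • v) = k * innerPerp a v := by
  simp [innerPerp]; ring

theorem innerPerp_self (v : Grid) : innerPerp v v = 0 := by
  simp [innerPerp]; ring

/-- A primitive vector belongs to a basis of `ℤ²`. -/
theorem IsPrimitive.exists_dual {v : Grid} (hv : IsPrimitive v) : ∃ w, innerPerp w v = 1 := by
  obtain ⟨a, b, h⟩ := hv
  exact ⟨(b, -a), by simp [innerPerp]; linarith⟩

theorem eq_smul_add_smul {v w : Grid} (h : innerPerp w v = 1) (u : Grid) :
    u = innerPerp w u • v + innerPerp u v • w := by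
  simp only [innerPerp] at *
  ext
  · simp
    linear_combination (-u.1) * h
  · simp
    linear_combination (-u.2) * h

/-- The evaluation `X^v ↦ ζ`, for a basis `(v, w)` of `ℤ²`: it maps `X^{αv + βw}` to `ζ^α Y^β`. -/
noncomputable def slice (v w : Grid) (ζ : ℂˣ) : LPoly →ₐ[ℂ] AddMonoidAlgebra ℂ ℤ :=
  AddMonoidAlgebra.lift ℂ _ Grid
    { toFun := fun u => single (innerPerp u.toAdd v) ((ζ ^ innerPerp w u.toAdd : ℂˣ) : ℂ)
      map_one' := by
        simp [innerPerp, one_def, -LaurentPolynomial.single_eq_C_mul_T]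
      map_mul' := fun s t => by
        rw [single_mul_single, toAdd_mul, innerPerp_add_left, innerPerp_add_right, zpow_add,
          Units.val_mul] }

theorem slice_single (v w : Grid) (ζ : ℂˣ) (u : Grid) (r : ℂ) :
    slice v w ζ (single u r) =
      single (innerPerp u v) (r * ((ζ ^ innerPerp w u : ℂˣ) : ℂ)) := by
  simp [slice, AddMonoidAlgebra.lift_single, -LaurentPolynomial.single_eq_C_mul_T]

/-- The substitution `Y ↦ X^w`. -/
noncomputable def embed (w : Grid) : AddMonoidAlgebra ℂ ℤ →ₐ[ℂ] LPoly :=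
  AddMonoidAlgebra.lift ℂ _ ℤ
    { toFun := fun n => single (n.toAdd • w) 1
      map_one' := by simp [one_def]
      map_mul' := fun s t => by simp [single_mul_single, add_smul] }

theorem embed_single (w : Grid) (n : ℤ) (r : ℂ) : embed w (single n r) = single (n • w) r := by
  simp [embed, AddMonoidAlgebra.lift_single, -LaurentPolynomial.single_eq_C_mul_T]

theorem single_sub_dvd_single_zsmul_sub (v : Grid) (ζ : ℂˣ) (n : ℤ) :
    (single v 1 - single 0 (ζ : ℂ) : LPoly) ∣
      single (n • v) 1 - single 0 ((ζ ^ n : ℂˣ) : ℂ) := by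
  have key : ∀ k : ℕ, (single v 1 - single 0 (ζ : ℂ) : LPoly) ∣
      single (k • v) 1 - single 0 ((ζ : ℂ) ^ k) := fun k => by
    have := sub_dvd_pow_sub_pow (single v 1 : LPoly) (single 0 (ζ : ℂ)) k
    simpa [single_pow] using this
  obtain ⟨k, rfl | rfl⟩ := n.eq_nat_or_neg
  · simpa using key k
  · have h : (single (-(k : ℤ) • v) 1 - single 0 ((ζ ^ (-(k : ℤ)) : ℂˣ) : ℂ) : LPoly) =
        -single (-(k : ℤ) • v) ((ζ ^ (-(k : ℤ)) : ℂˣ) : ℂ) *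
          (single (k • v) 1 - single 0 ((ζ : ℂ) ^ k)) := by
      simp [mul_sub, single_mul_single]
      abel
    rw [h]
    exact (key k).mul_left _

theorem single_sub_dvd_sub_embed_slice {v w : Grid} (h : innerPerp w v = 1) (ζ : ℂˣ) (f : LPoly) :
    (single v 1 - single 0 (ζ : ℂ) : LPoly) ∣ f - embed w (slice v w ζ f) := by
  induction f using AddMonoidAlgebra.induction_linear with
  | zero => simp
  | add f g hf hg =>
    convert dvd_add hf hg using 1
    simp only [map_add]
    ring
  | single u r =>
    have : (single u r - embed w (slice v w ζ (single u r)) : LPoly) =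
        single (innerPerp u v • w) r *
          (single (innerPerp w u • v) 1 - single 0 ((ζ ^ innerPerp w u : ℂˣ) : ℂ)) := by
      rw [slice_single, embed_single, mul_sub, single_mul_single, single_mul_single, add_zero,
        mul_one, add_comm, ← eq_smul_add_smul h u]
    rw [this]
    exact (single_sub_dvd_single_zsmul_sub v ζ _).mul_left _

theorem diff_smul_eq_prod (v : Grid) {N : ℕ} (hN : 0 < N) :
    diff ℂ ((N : ℤ) • v) =
      ∏ ζ ∈ Polynomial.nthRootsFinset N (1 : ℂ), (single v 1 - single 0 ζ : LPoly) := by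
  have h := congrArg (Polynomial.aeval (single v 1 : LPoly))
    (Polynomial.X_pow_sub_one_eq_prod hN (Complex.isPrimitiveRoot_exp N hN.ne'))
  simpa [diff, map_prod, single_pow, coe_algebraMap] using h

theorem act_embed (w : Grid) (h : AddMonoidAlgebra ℂ ℤ) (e : Grid → ℂ) (u : Grid) (i : ℤ) :
    act (embed w h) e (u + i • w) = act h (fun k => e (u + k • w)) i := by
  induction h using AddMonoidAlgebra.induction_linear with
  | zero => simp
  | add f g hf hg => rw [map_add, map_add, map_add, LinearMap.add_apply, LinearMap.add_apply,
      Pi.add_apply, Pi.add_apply, hf, hg]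
  | single t r => rw [embed_single, act_single, act_single, sub_smul, add_sub_assoc]

/-- An `Nv`-periodic configuration with finitely many values, annihilated by a polynomial `f` which
does not vanish at `X^v = ζ` for any `N`-th root of unity `ζ`, is two-periodic. The annihilator
`∏ (f - f(ζ, Y))`, a multiple of `∏ (X^v - ζ) = X^{Nv} - 1`, is modulo `f` equal to `∏ -f(ζ, Y)`, so
that the configuration satisfies a linear recurrence along each line in direction `w`. -/
theorem exists_two_periods {v w : Grid} (hw : innerPerp w v = 1) {N : ℕ} (hN : 0 < N) {f : LPoly}
    (hf : ∀ ζ : ℂˣ, ζ ^ N = 1 → slice v w ζ f ≠ 0) {e : Grid → ℂ} (he : (Set.range e).Finite)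
    (hfe : act f e = 0) (hNe : act (diff ℂ ((N : ℤ) • v)) e = 0) :
    ∃ K : ℤ, 0 < K ∧ ∀ u : Grid, act (diff ℂ (K • u)) e = 0 := by
  have hex : ∀ ζ : ℂ, ∃ h : AddMonoidAlgebra ℂ ℤ, ζ ^ N = 1 →
      h ≠ 0 ∧ (single v 1 - single 0 ζ : LPoly) ∣ f - embed w h := by
    intro ζ
    by_cases h1 : ζ ^ N = 1
    · have hζ : ζ ≠ 0 := fun h => by simp [h, hN.ne'] at h1
      exact ⟨slice v w (Units.mk0 ζ hζ) f, fun _ => ⟨hf _ (by ext; simpa using h1),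
        single_sub_dvd_sub_embed_slice hw (Units.mk0 ζ hζ) f⟩⟩
    · exact ⟨0, fun h => absurd h h1⟩
  choose h hh using hex
  set Z := Polynomial.nthRootsFinset N (1 : ℂ)
  have hZ : ∀ ζ ∈ Z, ζ ^ N = 1 := fun ζ hζ => (Polynomial.mem_nthRootsFinset hN 1).1 hζ
  have hprod0 : ∏ ζ ∈ Z, -h ζ ≠ 0 :=
    Finset.prod_ne_zero_iff.2 fun ζ hζ => neg_ne_zero.2 (hh ζ (hZ ζ hζ)).1
  have hann1 : act (∏ ζ ∈ Z, (f - embed w (h ζ))) e = 0 := by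
    refine act_eq_zero_of_dvd ?_ hNe
    rw [diff_smul_eq_prod v hN]
    exact Finset.prod_dvd_prod_of_dvd _ _ fun ζ hζ => (hh ζ (hZ ζ hζ)).2
  have hdvd : f ∣ ∏ ζ ∈ Z, (f - embed w (h ζ)) - embed w (∏ ζ ∈ Z, -h ζ) := by
    rw [← Ideal.mem_span_singleton, ← Ideal.Quotient.eq, map_prod, map_prod, map_prod]
    refine Finset.prod_congr rfl fun ζ _ => ?_
    rw [Ideal.Quotient.eq, map_neg, sub_neg_eq_add, sub_add_cancel]
    exact Ideal.mem_span_singleton_self f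
  have hann2 : act (embed w (∏ ζ ∈ Z, -h ζ)) e = 0 := by
    have := act_eq_zero_of_dvd hdvd hfe
    rwa [map_sub, LinearMap.sub_apply, hann1, zero_sub, neg_eq_zero] at this
  obtain ⟨T, hT, hper⟩ := exists_period_of_recurrence hprod0 he
  have hTe : act (diff ℂ ((T : ℤ) • w)) e = 0 := by
    rw [act_diff_eq_zero_iff]
    intro u
    have := hper (fun k => e (u + k • w)) (fun i => ⟨_, rfl⟩) (by
      funext i
      rw [← act_embed, hann2]; rfl) 0
    simpa [sub_eq_add_neg] using this
  refine ⟨N * T, by positivity, fun u => ?_⟩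
  have h1 := act_diff_eq_zero_iff.1
    (act_eq_zero_of_dvd (diff_dvd_diff_zsmul _ (T * innerPerp w u)) hNe)
  have h2 := act_diff_eq_zero_iff.1
    (act_eq_zero_of_dvd (diff_dvd_diff_zsmul _ (N * innerPerp u v)) hTe)
  rw [act_diff_eq_zero_iff]
  intro x
  have hu : ((N * T : ℤ)) • u = (T * innerPerp w u : ℤ) • (N : ℤ) • v +
      (N * innerPerp u v : ℤ) • (T : ℤ) • w := by
    conv_lhs => rw [eq_smul_add_smul hw u]
    simp only [smul_add, smul_smul]
    congr 2 <;> ring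
  rw [hu, ← sub_sub, h2, h1]

end Slice

/-! ### Removing directions from an annihilating product -/

section Removal

/-- The factor `X^v - 1` can be removed: every `v`-periodic configuration `e` with finitely many
values for which `g e` is constant (as expressed by the annihilators `(X^t - 1) g`) is two-periodic,
being invariant under `K • ℤ²` for some `K > 0`. -/
def IsRemovable (g : LPoly) (v : Grid) : Prop :=
  ∀ e : Grid → ℂ, (Set.range e).Finite → (∀ t, act (diff ℂ t * g) e = 0) →
    act (diff ℂ v) e = 0 → ∃ K : ℤ, 0 < K ∧ ∀ u : Grid, act (diff ℂ (K • u)) e = 0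

/-- Parallel non-zero vectors have a common non-zero multiple. -/
theorem exists_common_smul {v v' : Grid} (hv : v ≠ 0) (hv' : v' ≠ 0) (h : innerPerp v v' = 0) :
    ∃ n m : ℤ, n • v = m • v' ∧ n • v ≠ 0 := by
  obtain ⟨a, b⟩ := v
  obtain ⟨c, d⟩ := v'
  simp only [innerPerp, sub_eq_zero, ne_eq, Prod.mk_eq_zero, not_and_or] at *
  by_cases ha : a = 0
  · subst ha
    have hb : b ≠ 0 := by simpa using hv
    have hc : c = 0 := by
      rcases mul_eq_zero.1 (show b * c = 0 by linarith) with h | h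
      · exact absurd h hb
      · exact h
    have hd : d ≠ 0 := by simpa [hc] using hv'
    exact ⟨d, b, by simp [hc, mul_comm], by simp [hb, hd]⟩
  · have hc : c ≠ 0 := fun hc => by
      have : d = 0 := by simpa [hc, ha] using h
      simp [hc, this] at hv'
    refine ⟨c, a, ?_, by simp [ha, hc]⟩
    ext
    · simp [mul_comm]
    · simp; linarith

/-- If a configuration `c` with finitely many values is annihilated by a product of difference
polynomials and `g c` is constant, then parallel directions and removable directions can be dropped
from the product, until at most one direction is left or two non-parallel directions that are not
removable are found. -/
theorem periods_or_not_removable {g : LPoly} {c : Grid → ℂ} (hc : (Set.range c).Finite)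
    (hg : ∀ t, act (diff ℂ t * g) c = 0) (L : List Grid) (hL : ∀ v ∈ L, v ≠ 0)
    (hLc : act (L.map (diff ℂ)).prod c = 0) :
    (∃ K : ℤ, 0 < K ∧ ∀ u : Grid, act (diff ℂ (K • u)) c = 0) ∨
      (∃ v, v ≠ 0 ∧ ¬ IsRemovable g v ∧ act (diff ℂ v) c = 0) ∨
      ∃ v v', v ≠ 0 ∧ v' ≠ 0 ∧ ¬ IsRemovable g v ∧ ¬ IsRemovable g v' ∧ innerPerp v v' ≠ 0 := by
  induction hn : L.length generalizing L with
  | zero =>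
    obtain rfl := List.length_eq_zero_iff.1 hn
    have hc0 : c = 0 := by simpa using hLc
    exact Or.inl ⟨1, one_pos, fun u => by rw [hc0, map_zero]⟩
  | succ n ih =>
    match L, hn with
    | [v], _ =>
      have hv : act (diff ℂ v) c = 0 := by simpa using hLc
      by_cases hr : IsRemovable g v
      · exact Or.inl (hr c hc hg hv)
      · exact Or.inr (Or.inl ⟨v, hL v (by simp), hr, hv⟩)
    | v :: v' :: L, hn =>
      have hv : v ≠ 0 := hL v (by simp)
      have hv' : v' ≠ 0 := hL v' (by simp)
      have hLL : ∀ x ∈ L, x ≠ 0 := fun x hx => hL x (by simp [hx])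
      set Q := (L.map (diff ℂ)).prod with hQ
      have hprod : act (diff ℂ v * (diff ℂ v' * Q)) c = 0 := by simpa using hLc
      -- a square `(X^x - 1)²` in the product shrinks to `X^x - 1`
      have shrink : ∀ x : Grid, x ≠ 0 → act (diff ℂ x * (diff ℂ x * Q)) c = 0 →
          (∃ K : ℤ, 0 < K ∧ ∀ u : Grid, act (diff ℂ (K • u)) c = 0) ∨
            (∃ v, v ≠ 0 ∧ ¬ IsRemovable g v ∧ act (diff ℂ v) c = 0) ∨
            ∃ v v', v ≠ 0 ∧ v' ≠ 0 ∧ ¬ IsRemovable g v ∧ ¬ IsRemovable g v' ∧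
              innerPerp v v' ≠ 0 := by
        intro x hx hxx
        refine ih (x :: L) (by simpa [hx] using hLL) ?_ (by simpa using hn)
        rw [act_mul, act_mul] at hxx
        have := act_diff_eq_zero_of_act_diff_act_diff (finite_range_act Q hc) hxx
        rwa [List.map_cons, List.prod_cons, act_mul]
      -- a removable direction `x` can be exchanged for a multiple of any other direction `y`
      have remove : ∀ x y : Grid, y ≠ 0 → IsRemovable g x →
          act (diff ℂ x * (diff ℂ y * Q)) c = 0 →
          ∃ K : ℤ, K • y ≠ 0 ∧ act (diff ℂ (K • y) * (diff ℂ (K • y) * Q)) c = 0 := by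
        intro x y hy hr hxy
        rw [act_mul] at hxy
        obtain ⟨K, hK, hKu⟩ := hr _ (finite_range_act (diff ℂ y * Q) hc)
          (fun t => by rw [← act_mul, act_mul', hg, map_zero]) hxy
        refine ⟨K, smul_ne_zero hK.ne' hy, ?_⟩
        have := hKu y
        rw [← act_mul] at this
        exact act_eq_zero_of_dvd
          (mul_dvd_mul_left _ (mul_dvd_mul_right (diff_dvd_diff_zsmul y K) Q)) this
      by_cases hr : IsRemovable g v
      · obtain ⟨K, hK, hKc⟩ := remove v v' hv' hr hprod
        exact shrink _ hK hKc
      by_cases hr' : IsRemovable g v'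
      · obtain ⟨K, hK, hKc⟩ := remove v' v hv hr' (by rwa [mul_left_comm])
        exact shrink _ hK hKc
      by_cases hpar : innerPerp v v' = 0
      · obtain ⟨n, m, hnm, hne⟩ := exists_common_smul hv hv' hpar
        refine shrink (n • v) hne (act_eq_zero_of_dvd (mul_dvd_mul (diff_dvd_diff_zsmul v n)
          (mul_dvd_mul_right ?_ Q)) hprod)
        rw [hnm]
        exact diff_dvd_diff_zsmul v' m
      · exact Or.inr (Or.inr ⟨v, v', hv, hv', hr, hr', hpar⟩)

end Removal

/-! ### Directions that are not removable -/

section Directions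

/-- `g` vanishes at `X^v = ζ` for some root of unity `ζ`, where `v` is part of a basis of `ℤ²`. This
means that the normal forms of the `v`-fibers of `g` have the common root `ζ`. -/
def VanishesAlong (g : LPoly) (v : Grid) : Prop :=
  ∃ w, innerPerp w v = 1 ∧ ∃ ζ : ℂˣ, ∃ N : ℕ, 0 < N ∧ ζ ^ N = 1 ∧ slice v w ζ g = 0

theorem isRemovable_smul {g : LPoly} {v : Grid} (hv : IsPrimitive v) (h : ¬ VanishesAlong g v)
    {N : ℕ} (hN : 0 < N) : IsRemovable g ((N : ℤ) • v) := by
  intro e he hge hve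
  obtain ⟨w, hw⟩ := hv.exists_dual
  -- the factor `X^w - 1` becomes `Y - 1`, which does not vanish
  refine exists_two_periods hw hN (f := diff ℂ w * g) (fun ζ hζ => ?_) he (hge w) hve
  have h1 : slice v w ζ (diff ℂ w) ≠ 0 := by
    rw [diff, map_sub, map_one, slice_single, hw, innerPerp_self, zpow_zero, one_def, sub_ne_zero]
    intro h
    rw [Units.val_one, mul_one, single_left_inj one_ne_zero] at h
    exact one_ne_zero h
  rw [map_mul]
  exact mul_ne_zero h1 fun h0 => h ⟨w, hw, ζ, N, hN, hζ, h0⟩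

theorem slice_eq_sum (v w : Grid) (ζ : ℂˣ) (f : LPoly) :
    slice v w ζ f = f.coeff.sum fun x r =>
      single (innerPerp x v) (r * ((ζ ^ innerPerp w x : ℂˣ) : ℂ)) := by
  conv_lhs => rw [← sum_coeff_single f]
  rw [map_finsuppSum]
  simp only [slice_single]

theorem coeff_slice (v w : Grid) (ζ : ℂˣ) (f : LPoly) (n : ℤ) :
    (slice v w ζ f).coeff n = ∑ x ∈ f.coeff.support with innerPerp x v = n,
      f.coeff x * ((ζ ^ innerPerp w x : ℂˣ) : ℂ) := by
  rw [slice_eq_sum, Finsupp.sum, coeff_sum, Finsupp.finsetSum_apply, Finset.sum_filter]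
  simp only [coeff_single, Finsupp.single_apply]

/-- If `v` is not the direction of an outer edge, then `g` has an extremal `v`-fiber which is a
monomial, so `g` vanishes along `v` only for outer edge directions `v`. -/
theorem VanishesAlong.mem_outerEdgeDirections {g : LPoly} (hg : g ≠ 0) {v : Grid}
    (hv : IsPrimitive v) (h : VanishesAlong g v) : v ∈ outerEdgeDirections g := by
  obtain ⟨w, hw, ζ, -, -, -, h0⟩ := h
  refine ⟨hv, ?_⟩
  have hne : g.coeff.support.Nonempty := by
    rw [Finsupp.support_nonempty_iff]; simpa using hg
  obtain ⟨t, ht, hmin⟩ := Finset.exists_min_image _ (fun x => innerPerp x v) hne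
  refine ⟨t, fun u hu => by rw [innerPerp_sub_left, sub_nonneg]; exact hmin u hu, ?_⟩
  by_contra! hlt
  have htm : t ∈ g.coeff.support.filter fun u => innerPerp (u - t) v = 0 := by
    simp only [Finset.mem_filter]
    exact ⟨ht, by simp [innerPerp]⟩
  have hsing := Finset.card_eq_one.1
    (le_antisymm (by omega) (Finset.card_pos.2 ⟨t, htm⟩))
  obtain ⟨t', ht'⟩ := hsing
  obtain rfl : t = t' := by simpa [ht'] using htm
  -- the coefficient at the extremal line is `g_t` times a power of `ζ`
  have hcoeff := coeff_slice v w ζ g (innerPerp t v)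
  simp only [innerPerp_sub_left, sub_eq_zero] at ht'
  rw [h0, ht', Finset.sum_singleton] at hcoeff
  simp only [coeff_zero, Finsupp.coe_zero, Pi.zero_apply] at hcoeff
  exact mul_ne_zero (Finsupp.mem_support_iff.1 ht) (Units.ne_zero _) hcoeff.symm

theorem exists_vanishing_of_not_isRemovable {g : LPoly} (hg : g ≠ 0) {u : Grid} (hu : u ≠ 0)
    (h : ¬ IsRemovable g u) :
    ∃ v ∈ outerEdgeDirections g, VanishesAlong g v ∧ ∃ N : ℤ, u = N • v := by
  have hgcd : 0 < Int.gcd u.1 u.2 := by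
    rw [Int.gcd_pos_iff]
    by_contra! h0
    exact hu (Prod.ext h0.1 h0.2)
  obtain ⟨N, m, n, hN, hmn, h1, h2⟩ := Int.exists_gcd_one' hgcd
  have hv : IsPrimitive (m, n) := Int.isCoprime_iff_gcd_eq_one.2 hmn
  have huv : u = (N : ℤ) • ((m, n) : Grid) := by
    ext
    · simp [h1, mul_comm]
    · simp [h2, mul_comm]
  have hvan : VanishesAlong g (m, n) := by
    by_contra hvan
    exact h (huv ▸ isRemovable_smul hv hvan hN)
  exact ⟨_, hvan.mem_outerEdgeDirections hg hv, hvan, N, huv⟩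

end Directions

/-! ### Coverings -/

section Covering

/-- The polynomial of a covering, with integer coefficients. -/
noncomputable def intCoveringPoly (D : Finset Grid) (b a : ℕ) : AddMonoidAlgebra ℤ Grid :=
  ∑ u ∈ D, single (-u) 1 - single 0 ((b : ℤ) - a)

theorem mapRingHom_intCoveringPoly (D : Finset Grid) (b a : ℕ) :
    mapRingHom Grid (Int.castRingHom ℂ) (intCoveringPoly D b a) = coveringPoly D b a := by
  simp [intCoveringPoly, coveringPoly, charPoly, mapRingHom_single]

/-- A configuration, as a function with integer values. -/
def toInt (c : Grid → Fin 2) (u : Grid) : ℤ := ((c u : ℕ) : ℤ)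

theorem toInt_injective_at {c : Grid → Fin 2} {u u' : Grid} (h : toInt c u = toInt c u') :
    c u = c u' := Fin.ext (Int.ofNat_inj.1 h)

theorem act_intCoveringPoly {D : Finset Grid} {b a : ℕ} {c : Grid → Fin 2}
    (hc : IsCovering D b a c) (u : Grid) : act (intCoveringPoly D b a) (toInt c) u = a := by
  have hsum : ∑ w ∈ D, toInt c (u + w) = (D.filter (fun w => c (u + w) = 1)).card := by
    rw [Finset.card_filter, Nat.cast_sum]
    refine Finset.sum_congr rfl fun w _ => ?_
    unfold toInt
    generalize c (u + w) = x
    fin_cases x <;> simp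
  have h : act (intCoveringPoly D b a) (toInt c) u =
      ∑ w ∈ D, toInt c (u + w) - ((b : ℤ) - a) * toInt c u := by
    simp [intCoveringPoly, act_single, map_sum, sub_mul]
  rw [h, hsum]
  obtain ⟨h1, h0⟩ := hc u
  rcases (by omega : c u = 1 ∨ c u = 0) with hu | hu
  · rw [h1 hu]; simp [toInt, hu]
  · rw [h0 hu]; simp [toInt, hu]

theorem IsTwoPeriodic.isPeriodic {c : Grid → Fin 2} (h : IsTwoPeriodic c) : IsPeriodic c := by
  obtain ⟨t₁, t₂, hli, h1, -⟩ := h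
  exact ⟨t₁, hli.ne_zero 0, h1⟩

/-- A covering is two-periodic, or its polynomial `g` vanishes along some outer edge direction; a
covering which is not periodic forces `g` to vanish along two non-parallel ones. -/
theorem covering_periodicity {D : Finset Grid} {b a : ℕ} (hg : coveringPoly D b a ≠ 0)
    {c : Grid → Fin 2} (hc : IsCovering D b a c) :
    IsTwoPeriodic c ∨
      (∃ v ∈ outerEdgeDirections (coveringPoly D b a), VanishesAlong (coveringPoly D b a) v ∧
        IsPeriodic c) ∨
      ∃ v ∈ outerEdgeDirections (coveringPoly D b a),
        ∃ v' ∈ outerEdgeDirections (coveringPoly D b a), VanishesAlong (coveringPoly D b a) v ∧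
          VanishesAlong (coveringPoly D b a) v' ∧ ¬ IsParallel v v' := by
  have hdg : ∀ t, act (diff ℤ t * intCoveringPoly D b a) (toInt c) = 0 := fun t => by
    funext u
    rw [act_mul, act_diff, act_intCoveringPoly hc, act_intCoveringPoly hc, sub_self]; rfl
  have hg' : intCoveringPoly D b a ≠ 0 := fun h => hg (by
    rw [← mapRingHom_intCoveringPoly, h, map_zero])
  have hd0 : diff ℤ ((1, 0) : Grid) ≠ 0 := by
    rw [diff, sub_ne_zero, one_def, Ne, single_left_inj one_ne_zero]
    simp
  have hbd : ∀ u, |toInt c u| ≤ 1 := fun u => by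
    rw [toInt, abs_le]; omega
  obtain ⟨L, hL, hLc⟩ := exists_prod_diff_annihilates hbd (mul_ne_zero hd0 hg') (hdg (1, 0))
  set e : Grid → ℂ := Int.castRingHom ℂ ∘ toInt c with he
  have hmap : ∀ {f : AddMonoidAlgebra ℤ Grid}, act f (toInt c) = 0 →
      act (mapRingHom Grid (Int.castRingHom ℂ) f) e = 0 := fun h => by
    funext u
    rw [he, act_mapRingHom, h]; simp
  have hdiff : ∀ t : Grid, mapRingHom Grid (Int.castRingHom ℂ) (diff ℤ t) = diff ℂ t := fun t => by
    simp [diff, mapRingHom_single]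
  have hfin : (Set.range e).Finite := by
    refine (Set.finite_range fun x : Fin 2 => (((x : ℕ) : ℤ) : ℂ)).subset ?_
    rintro _ ⟨u, rfl⟩
    exact ⟨c u, rfl⟩
  have hper : ∀ {t : Grid}, act (diff ℂ t) e = 0 → translate t c = c := fun {t} h => by
    funext u
    have := act_diff_eq_zero_iff.1 h u
    exact toInt_injective_at (Int.cast_injective this)
  have hge : ∀ t, act (diff ℂ t * coveringPoly D b a) e = 0 := fun t => by
    have := hmap (hdg t)
    rwa [map_mul, hdiff, mapRingHom_intCoveringPoly] at this
  have hLe : act (L.map (diff ℂ)).prod e = 0 := by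
    have := hmap hLc
    rw [map_list_prod, List.map_map] at this
    rwa [show (mapRingHom Grid (Int.castRingHom ℂ) : _ → _) ∘ diff ℤ = diff ℂ from
      funext hdiff] at this
  rcases periods_or_not_removable hfin hge L hL hLe with
    ⟨K, hK, h⟩ | ⟨v, hv, hr, h⟩ | ⟨v, v', hv, hv', hr, hr', hpar⟩
  · refine Or.inl ⟨K • (1, 0), K • (0, 1), ?_, hper (h _), hper (h _)⟩
    rw [LinearIndependent.pair_iff]
    intro s t hst
    simpa [hK.ne'] using hst
  · obtain ⟨x, hx, hvan, -⟩ := exists_vanishing_of_not_isRemovable hg hv hr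
    exact Or.inr (Or.inl ⟨x, hx, hvan, v, hv, hper h⟩)
  · obtain ⟨x, hx, hvan, n, rfl⟩ := exists_vanishing_of_not_isRemovable hg hv hr
    obtain ⟨y, hy, hvan', m, rfl⟩ := exists_vanishing_of_not_isRemovable hg hv' hr'
    refine Or.inr (Or.inr ⟨x, hx, y, hy, hvan, hvan', fun hp => hpar ?_⟩)
    rw [innerPerp_smul_left, innerPerp_smul_right, show innerPerp x y = 0 from hp]
    simp

end Covering

/-! ### Fibers and their normal forms -/

section Fibers

theorem exists_eq_add_smul_iff {v w : Grid} (hw : innerPerp w v = 1) {x u : Grid} :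
    (∃ k : ℤ, x = u + k • v) ↔ innerPerp x v = innerPerp u v := by
  constructor
  · rintro ⟨k, rfl⟩
    rw [innerPerp_add_left, innerPerp_smul_left, innerPerp_self]
    ring
  · intro h
    refine ⟨innerPerp w x - innerPerp w u, ?_⟩
    have hx := eq_smul_add_smul hw x
    have hu := eq_smul_add_smul hw u
    rw [h] at hx
    linear_combination hx - hu

theorem coeff_fiber (v : Grid) (g : LPoly) (u x : Grid) [Decidable (∃ k : ℤ, x = u + k • v)] :
    (fiber v g u).coeff x = if ∃ k : ℤ, x = u + k • v then g.coeff x else 0 := by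
  classical
  simp only [fiber, Finsupp.filter_apply]
  split_ifs <;> rfl

theorem slice_fiber_eq_zero {v w : Grid} (hw : innerPerp w v = 1) {ζ : ℂˣ} {g : LPoly}
    (h : slice v w ζ g = 0) (u : Grid) : slice v w ζ (fiber v g u) = 0 := by
  classical
  have h1 : (fiber v g u).coeff = g.coeff.filter fun x => innerPerp x v = innerPerp u v := by
    ext x
    rw [coeff_fiber, Finsupp.filter_apply]
    simp only [exists_eq_add_smul_iff hw]
  rw [← coeff_inj]
  ext n
  rw [coeff_slice, h1, Finsupp.support_filter, Finset.filter_filter]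
  by_cases hn : n = innerPerp u v
  · have := coeff_slice v w ζ g n
    rw [h] at this
    refine Eq.trans ?_ this.symm
    refine Finset.sum_congr ?_ fun x hx => ?_
    · ext x
      simp only [Finset.mem_filter]
      rw [← hn, and_self_iff]
    · rw [Finsupp.filter_apply, if_pos]
      rw [(Finset.mem_filter.1 hx).2, hn]
  · rw [Finset.sum_eq_zero]
    · rfl
    · intro x hx
      obtain ⟨-, h2, h3⟩ := Finset.mem_filter.1 hx
      exact absurd (h3.symm.trans h2) hn

theorem IsNormalForm.eval_eq_zero {v w : Grid} (hw : innerPerp w v = 1) {ζ : ℂˣ} {h : LPoly}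
    {p : Polynomial ℂ} (hp : IsNormalForm v h p) (h0 : slice v w ζ h = 0) :
    p.eval (ζ : ℂ) = 0 := by
  obtain ⟨-, u, rfl⟩ := hp
  have h1 : slice v w ζ (single v 1) = algebraMap ℂ (AddMonoidAlgebra ℂ ℤ) ζ := by
    rw [slice_single, hw, innerPerp_self, zpow_one, one_mul, coe_algebraMap]
    rfl
  rw [map_mul, ← Polynomial.aeval_algHom_apply, h1, Polynomial.aeval_algebraMap_apply,
    slice_single, coe_algebraMap, Function.comp_apply, single_mul_single, single_eq_zero] at h0
  simpa [zpow_ne_zero] using h0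

theorem eval_normalForm_fiber {v w : Grid} (hw : innerPerp w v = 1) {ζ : ℂˣ} {g : LPoly}
    (h : slice v w ζ g = 0) (u : Grid) : (normalForm v (fiber v g u)).eval (ζ : ℂ) = 0 := by
  unfold normalForm
  split_ifs with H
  · exact H.choose_spec.eval_eq_zero hw (slice_fiber_eq_zero hw h u)
  · simp

theorem coeff_single_mul_aeval (u v x : Grid) (p : Polynomial ℂ) :
    (single u 1 * Polynomial.aeval (single v 1 : LPoly) p : LPoly).coeff x =
      ∑ i ∈ p.support, if u + i • v = x then p.coeff i else 0 := by
  rw [Polynomial.aeval_eq_sum_range' (Nat.lt_succ_self _), Finset.mul_sum, coeff_sum,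
    Finsupp.finsetSum_apply, ← Finset.sum_subset Polynomial.supp_subset_range_natDegree_succ]
  · refine Finset.sum_congr rfl fun i _ => ?_
    rw [single_pow, smul_single, single_mul_single, coeff_single, Finsupp.single_apply]
    simp
  · intro i _ hi
    rw [Polynomial.notMem_support_iff.1 hi]
    simp

theorem nsmul_injective {v : Grid} (hv : v ≠ 0) : Function.Injective fun k : ℕ => k • v :=
  fun i j hij => by
    have : (i : ℤ) • v = (j : ℤ) • v := by simpa only [natCast_zsmul] using hij
    exact_mod_cast smul_left_injective ℤ hv this

theorem coeff_single_mul_aeval_smul {u v : Grid} (hv : v ≠ 0) (p : Polynomial ℂ) (k : ℕ) :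
    (single u 1 * Polynomial.aeval (single v 1 : LPoly) p : LPoly).coeff (u + k • v) =
      p.coeff k := by
  have h : ∀ i : ℕ, u + i • v = u + k • v ↔ i = k := fun i => by
    rw [add_right_inj]
    exact ⟨fun h => nsmul_injective hv h, fun h => by rw [h]⟩
  rw [coeff_single_mul_aeval]
  simp only [h, Finset.sum_ite_eq', Polynomial.mem_support_iff]
  split_ifs with hk
  · rfl
  · exact (not_not.1 hk).symm

theorem exists_of_coeff_single_mul_aeval_ne_zero {u v x : Grid} {p : Polynomial ℂ}
    (h : (single u 1 * Polynomial.aeval (single v 1 : LPoly) p : LPoly).coeff x ≠ 0) :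
    ∃ k : ℕ, x = u + k • v := by
  rw [coeff_single_mul_aeval] at h
  obtain ⟨i, -, hi⟩ := Finset.exists_ne_zero_of_sum_ne_zero h
  exact ⟨i, by by_contra hx; exact hi (if_neg (Ne.symm hx))⟩

theorem IsNormalForm.unique {v : Grid} (hv : v ≠ 0) {h : LPoly} {p q : Polynomial ℂ}
    (hp : IsNormalForm v h p) (hq : IsNormalForm v h q) : p = q := by
  obtain ⟨hp0, u, hu⟩ := hp
  obtain ⟨hq0, u', hu'⟩ := hq
  have key : u = u' := by
    have h1 : h.coeff u ≠ 0 := by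
      have := coeff_single_mul_aeval_smul (u := u) hv p 0
      rw [← hu, zero_smul, add_zero] at this
      rwa [this]
    have h2 : h.coeff u' ≠ 0 := by
      have := coeff_single_mul_aeval_smul (u := u') hv q 0
      rw [← hu', zero_smul, add_zero] at this
      rwa [this]
    rw [hu'] at h1
    rw [hu] at h2
    obtain ⟨k, hk⟩ := exists_of_coeff_single_mul_aeval_ne_zero h1
    obtain ⟨l, hl⟩ := exists_of_coeff_single_mul_aeval_ne_zero h2
    have h3 : (l + k) • v = 0 := by
      have : u = u + (l + k) • v := by
        conv_lhs => rw [hk, hl]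
        rw [add_smul, add_assoc]
      exact left_eq_add.1 this
    have h4 : k = 0 := by
      have := (smul_eq_zero.1 h3).resolve_right hv
      omega
    rw [hk, h4, zero_smul, add_zero]
  subst key
  ext k
  rw [← coeff_single_mul_aeval_smul (u := u) hv p k, ← hu, hu',
    coeff_single_mul_aeval_smul hv]

theorem normalForm_eq {v : Grid} (hv : v ≠ 0) {h : LPoly} {p : Polynomial ℂ}
    (hp : IsNormalForm v h p) : normalForm v h = p := by
  have H : ∃ p, IsNormalForm v h p := ⟨p, hp⟩
  rw [normalForm, dif_pos H]
  exact H.choose_spec.unique hv hp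

/-- A non-zero line polynomial in direction `v` with coefficients `0` and `1` and without gaps has
normal form `φ_n`. -/
theorem exists_isNormalForm_phi {v w : Grid} (hw : innerPerp w v = 1) {h : LPoly} (h0 : h ≠ 0)
    (hone : ∀ x ∈ h.coeff.support, h.coeff x = 1)
    (hline : ∀ x ∈ h.coeff.support, ∀ y ∈ h.coeff.support, innerPerp x v = innerPerp y v)
    (hgap : ∀ x ∈ h.coeff.support, ∀ k : ℕ, x + k • v ∈ h.coeff.support →
      ∀ i ≤ k, x + i • v ∈ h.coeff.support) :
    ∃ n, 1 ≤ n ∧ IsNormalForm v h (phi n) := by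
  classical
  have hv : v ≠ 0 := by
    rintro rfl
    simp [innerPerp] at hw
  have hne : h.coeff.support.Nonempty := by
    rw [Finsupp.support_nonempty_iff]; simpa using h0
  obtain ⟨x₀, hx₀, hmin⟩ := Finset.exists_min_image _ (innerPerp w) hne
  obtain ⟨x₁, hx₁, hmax⟩ := Finset.exists_max_image _ (innerPerp w) hne
  have hpos : ∀ x ∈ h.coeff.support, x = x₀ + (innerPerp w x - innerPerp w x₀).toNat • v := by
    intro x hx
    obtain ⟨k, hk⟩ := (exists_eq_add_smul_iff hw).2 (hline x hx x₀ hx₀)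
    have h1 : innerPerp w x - innerPerp w x₀ = k := by
      rw [hk, innerPerp_add_right, innerPerp_smul_right, hw]
      ring
    have h2 := hmin x hx
    rw [h1, ← natCast_zsmul, Int.toNat_of_nonneg (by omega), ← hk]
  set n := (innerPerp w x₁ - innerPerp w x₀).toNat with hn
  have hsupp : h.coeff.support = (Finset.range (n + 1)).image fun i : ℕ => x₀ + i • v := by
    ext x
    simp only [Finset.mem_image, Finset.mem_range]
    constructor
    · intro hx
      refine ⟨_, ?_, (hpos x hx).symm⟩
      have h1 := hmin x hx
      have h2 := hmax x hx
      omega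
    · rintro ⟨i, hi, rfl⟩
      refine hgap x₀ hx₀ n ?_ i (by omega)
      rw [hn, ← hpos x₁ hx₁]
      exact hx₁
  refine ⟨n + 1, by omega, by simp [phi, Polynomial.coeff_X_pow], x₀, ?_⟩
  conv_lhs => rw [← sum_coeff_single h]
  rw [Finsupp.sum, Finset.sum_congr rfl fun x hx => by rw [hone x hx], hsupp,
    Finset.sum_image fun i _ j _ hij => nsmul_injective hv (add_left_cancel hij)]
  simp [phi, map_sum, Finset.mul_sum, single_pow, single_mul_single]

end Fibers

/-! ### Convex shapes -/

section Convexity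

theorem IsConvexShape.add_smul_mem {D : Finset Grid} (hD : IsConvexShape D) {x v : Grid} {k i : ℕ}
    (hx : x ∈ D) (hk : x + k • v ∈ D) (hi : i ≤ k) : x + i • v ∈ D := by
  rcases Nat.eq_zero_or_pos k with rfl | hk0
  · obtain rfl : i = 0 := by omega
    simpa using hx
  have hmem : ∀ y ∈ D, toReal y ∈ convexHull ℝ (toReal '' (D : Set Grid)) := fun y hy =>
    subset_convexHull ℝ _ ⟨y, hy, rfl⟩
  have hk' : (0 : ℝ) < k := by exact_mod_cast hk0
  have hik : (i : ℝ) ≤ k := by exact_mod_cast hi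
  have h := (convex_convexHull ℝ (toReal '' (D : Set Grid))) (hmem _ hx) (hmem _ hk)
    (a := 1 - i / k) (b := i / k) (by rw [sub_nonneg]; exact (div_le_one hk').2 hik)
    (by positivity) (by ring)
  rw [← Finset.mem_coe, hD, Set.mem_ofPred_eq]
  convert h using 1
  ext
  · simp [toReal]; field_simp; ring
  · simp [toReal]; field_simp; ring

theorem coeff_coveringPoly (D : Finset Grid) (b a : ℕ) (x : Grid) :
    (coveringPoly D b a).coeff x =
      (if -x ∈ D then 1 else 0) - if x = 0 then (b : ℂ) - a else 0 := by
  classical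
  have h : ∀ u : Grid, -u = x ↔ u = -x := fun u => neg_eq_iff_eq_neg
  rw [coveringPoly, charPoly, coeff_sub, coeff_sum, Finsupp.sub_apply, Finsupp.finsetSum_apply]
  simp only [coeff_single, Finsupp.single_apply, h, Finset.sum_ite_eq', eq_comm (a := (0 : Grid))]

/-- A non-zero fiber of the polynomial of a convex shape has normal form `φ_n`, if it does not meet
the constant term `-(b - a)`. -/
theorem exists_normalForm_eq_phi {D : Finset Grid} (hD : IsConvexShape D) {b a : ℕ} {v : Grid}
    (hv : IsPrimitive v) {u : Grid} (hu : (b : ℤ) - a = 0 ∨ ∀ k : ℤ, u ≠ k • v)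
    (h0 : fiber v (coveringPoly D b a) u ≠ 0) :
    ∃ n, 1 ≤ n ∧ normalForm v (fiber v (coveringPoly D b a) u) = phi n := by
  classical
  obtain ⟨w, hw⟩ := hv.exists_dual
  have hv0 : v ≠ 0 := by
    rintro rfl
    simp [innerPerp] at hw
  have hcoeff : ∀ x, (fiber v (coveringPoly D b a) u).coeff x =
      if -x ∈ D ∧ innerPerp x v = innerPerp u v then 1 else 0 := by
    intro x
    rw [coeff_fiber, coeff_coveringPoly]
    simp only [exists_eq_add_smul_iff hw]
    by_cases hx : innerPerp x v = innerPerp u v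
    · have h1 : (if x = 0 then (b : ℂ) - a else 0) = 0 := by
        split_ifs with hx0
        · rcases hu with hba | hu
          · exact_mod_cast hba
          · obtain ⟨k, hk⟩ := (exists_eq_add_smul_iff hw).2 hx
            refine absurd ?_ (hu (-k))
            rw [neg_smul, eq_neg_iff_add_eq_zero, ← hk, hx0]
        · rfl
      simp [hx, h1]
    · simp [hx]
  have hsupp : ∀ x, x ∈ (fiber v (coveringPoly D b a) u).coeff.support ↔
      -x ∈ D ∧ innerPerp x v = innerPerp u v := fun x => by
    rw [Finsupp.mem_support_iff, hcoeff]
    simp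
  obtain ⟨n, hn, hnf⟩ := exists_isNormalForm_phi hw h0
    (fun x hx => by rw [hcoeff, if_pos ((hsupp x).1 hx)])
    (fun x hx y hy => ((hsupp x).1 hx).2.trans ((hsupp y).1 hy).2.symm)
    (fun x hx k hk i hi => by
      rw [hsupp] at hx hk ⊢
      refine ⟨?_, ?_⟩
      · have h1 : -x + k • -v ∈ D := by
          have := hk.1
          rwa [neg_add, ← smul_neg] at this
        have := hD.add_smul_mem hx.1 h1 hi
        rwa [neg_add, ← smul_neg]
      · rw [← hx.2, ← natCast_zsmul]
        exact (exists_eq_add_smul_iff hw).1 ⟨i, rfl⟩)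
  exact ⟨n, hn, normalForm_eq hv0 hnf⟩

end Convexity

/-! ### Common roots of the polynomials `φ_n` -/

section Phi

/-- A common root of the `φ_n`, `n ∈ S`, is a root of `φ_d` for `d = gcd S`. -/
theorem eval_phi_setGcd {S : Set ℕ} {ζ : ℂ} (h : ∀ n ∈ S, 1 ≤ n ∧ (phi n).eval ζ = 0) :
    (phi (Nat.setGcd S)).eval ζ = 0 := by
  have heval : ∀ n, (phi n).eval ζ = ∑ i ∈ Finset.range n, ζ ^ i := fun n => by
    simp [phi, Polynomial.eval_finsetSum]
  simp only [heval] at *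
  rcases S.eq_empty_or_nonempty with rfl | ⟨n, hn⟩
  · rw [Nat.setGcd_eq_zero_iff.2 (Set.empty_subset _)]; simp
  have h1 : ζ ≠ 1 := by
    rintro rfl
    obtain ⟨h1, h2⟩ := h n hn
    simp at h2
    omega
  have hpow : ∀ m ∈ S, orderOf ζ ∣ m := fun m hm => by
    rw [orderOf_dvd_iff_pow_eq_one, ← sub_eq_zero, ← geom_sum_mul, (h m hm).2, zero_mul]
  have hd := orderOf_dvd_iff_pow_eq_one.1 (Nat.dvd_setGcd_iff.2 hpow)
  rw [← sub_eq_zero, ← geom_sum_mul] at hd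
  exact (mul_eq_zero.1 hd).resolve_right (sub_ne_zero.2 h1)

theorem phi_one : phi 1 = 1 := by simp [phi]

theorem VanishesAlong.setGcd_ne_one {g : LPoly} {v : Grid} (h : VanishesAlong g v) :
    Nat.setGcd (lengths (fiberForms v g)) ≠ 1 := by
  obtain ⟨w, hw, ζ, -, -, -, h0⟩ := h
  intro h1
  have := eval_phi_setGcd (S := lengths (fiberForms v g)) (ζ := (ζ : ℂ)) (by
    rintro n ⟨hn, u, -, hu⟩
    exact ⟨hn, hu ▸ eval_normalForm_fiber hw h0 u⟩)
  simp [h1, phi_one] at this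

theorem VanishesAlong.not_isRelPrime {g : LPoly} {v : Grid} (h : VanishesAlong g v) :
    ¬ IsRelPrime (phi (Nat.setGcd (lengths (fiberForms' v g)))) (originForm v g) := by
  obtain ⟨w, hw, ζ, -, -, -, h0⟩ := h
  intro hrel
  have h1 := eval_phi_setGcd (S := lengths (fiberForms' v g)) (ζ := (ζ : ℂ)) (by
    rintro n ⟨hn, u, -, -, hu⟩
    exact ⟨hn, hu ▸ eval_normalForm_fiber hw h0 u⟩)
  exact Polynomial.not_isUnit_X_sub_C (ζ : ℂ) (hrel (Polynomial.dvd_iff_isRoot.2 h1)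
    (Polynomial.dvd_iff_isRoot.2 (eval_normalForm_fiber hw h0 0)))

theorem eq_image_phi_lengths {F : Set (Polynomial ℂ)} (h : ∀ p ∈ F, ∃ n, 1 ≤ n ∧ p = phi n) :
    F = phi '' lengths F := by
  ext p
  constructor
  · intro hp
    obtain ⟨n, hn, rfl⟩ := h p hp
    exact ⟨n, ⟨hn, hp⟩, rfl⟩
  · rintro ⟨n, ⟨-, hn⟩, rfl⟩
    exact hn

end Phi

end PerfectCovering

theorem mainTheorem3 (D : Finset PerfectCovering.Grid)
    (hD : PerfectCovering.IsConvexShape D) (b a : ℕ)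
    (g : PerfectCovering.LPoly) (hg : g = PerfectCovering.coveringPoly D b a) (hg0 : g ≠ 0)
    (E : Set PerfectCovering.Grid) (hE : E = PerfectCovering.outerEdgeDirections g) :
    ((b : ℤ) - (a : ℤ) = 0 →
      ∀ d : PerfectCovering.Grid → ℕ,
        (∀ v, d v = Nat.setGcd (PerfectCovering.lengths (PerfectCovering.fiberForms v g))) →
        (∀ v ∈ E, PerfectCovering.fiberForms v g =
          PerfectCovering.phi '' PerfectCovering.lengths (PerfectCovering.fiberForms v g)) ∧
        ((∀ v ∈ E, d v = 1) →
          ∀ c, PerfectCovering.IsCovering D b a c → PerfectCovering.IsTwoPeriodic c) ∧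
        ((∀ v ∈ E, ∀ w ∈ E, d v ≠ 1 → d w ≠ 1 → PerfectCovering.IsParallel v w) →
          ∀ c, PerfectCovering.IsCovering D b a c → PerfectCovering.IsPeriodic c)) ∧
    ((b : ℤ) - (a : ℤ) ≠ 0 →
      ∀ d : PerfectCovering.Grid → ℕ,
        (∀ v, d v = Nat.setGcd (PerfectCovering.lengths (PerfectCovering.fiberForms' v g))) →
        (∀ v ∈ E, PerfectCovering.fiberForms' v g =
          PerfectCovering.phi '' PerfectCovering.lengths (PerfectCovering.fiberForms' v g)) ∧
        ((∀ v ∈ E, IsRelPrime (PerfectCovering.phi (d v)) (PerfectCovering.originForm v g)) →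
          ∀ c, PerfectCovering.IsCovering D b a c → PerfectCovering.IsTwoPeriodic c) ∧
        ((∀ v ∈ E, ∀ w ∈ E,
            ¬ IsRelPrime (PerfectCovering.phi (d v)) (PerfectCovering.originForm v g) →
            ¬ IsRelPrime (PerfectCovering.phi (d w)) (PerfectCovering.originForm w g) →
            PerfectCovering.IsParallel v w) →
          ∀ c, PerfectCovering.IsCovering D b a c → PerfectCovering.IsPeriodic c) ∧
        (∀ v ∈ E, d v = 1 →
          IsRelPrime (PerfectCovering.phi (d v)) (PerfectCovering.originForm v g))) := by
  subst hg hE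
  refine ⟨fun hba d hd => ⟨fun v hv => ?_, fun h c hc => ?_, fun h c hc => ?_⟩,
    fun hba d hd => ⟨fun v hv => ?_, fun h c hc => ?_, fun h c hc => ?_, fun v hv hdv => ?_⟩⟩
  · refine PerfectCovering.eq_image_phi_lengths ?_
    rintro _ ⟨u, hu, rfl⟩
    exact PerfectCovering.exists_normalForm_eq_phi hD hv.1 (Or.inl hba) hu
  · rcases PerfectCovering.covering_periodicity hg0 hc with
      h2 | ⟨v, hv, hvan, -⟩ | ⟨v, hv, -, -, hvan, -⟩
    · exact h2
    all_goals exact absurd ((hd v).symm.trans (h v hv)) hvan.setGcd_ne_one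
  · rcases PerfectCovering.covering_periodicity hg0 hc with
      h2 | ⟨-, -, -, h1⟩ | ⟨v, hv, w, hw, hvan, hwan, hp⟩
    · exact h2.isPeriodic
    · exact h1
    · exact absurd (h v hv w hw (hd v ▸ hvan.setGcd_ne_one) (hd w ▸ hwan.setGcd_ne_one)) hp
  · refine PerfectCovering.eq_image_phi_lengths ?_
    rintro _ ⟨u, hu0, hu, rfl⟩
    exact PerfectCovering.exists_normalForm_eq_phi hD hv.1 (Or.inr hu0) hu
  · rcases PerfectCovering.covering_periodicity hg0 hc with
      h2 | ⟨v, hv, hvan, -⟩ | ⟨v, hv, -, -, hvan, -⟩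
    · exact h2
    all_goals exact absurd (hd v ▸ h v hv) hvan.not_isRelPrime
  · rcases PerfectCovering.covering_periodicity hg0 hc with
      h2 | ⟨-, -, -, h1⟩ | ⟨v, hv, w, hw, hvan, hwan, hp⟩
    · exact h2.isPeriodic
    · exact h1
    · exact absurd (h v hv w hw (hd v ▸ hvan.not_isRelPrime) (hd w ▸ hwan.not_isRelPrime)) hp
  · rw [hdv, PerfectCovering.phi_one]
    exact isRelPrime_one_left
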